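/- Let $n\ge 1$ and let $S=\{x\in\mathbb R^{n+1} : \sum_{j=1}^{n+1}x_j=1,\ x_j\ge 0 \text{ for all } j\}$ be the regular $n$-simplex of side length $\sqrt2$. For $a\in\mathbb R^{n+1}$ put $H_a=\{x\in\mathbb R^{n+1}:\langle a,x\rangle=0\}$, and let $\mathrm{vol}_{n-1}$ denote the $(n-1)$-dimensional volume, i.e. the Lebesgue measure induced on $(n-1)$-dimensional affine subspaces of Euclidean space $\mathbb R^{n+1}$ (counting measure if $n=1$). Let $a\in\mathbb R^{n+1}$ with $\|a\|=1$ be such that the positive coordinates of $a$ are pairwise distinct (coordinates with different indices that are positive have different values) and such that $a$ has at least one positive and at least one negative coordinate. Then $\mathrm{vol}_{n-1}(H_a\cap S)$ is finite and $$\mathrm{vol}_{n-1}(H_a\cap S)=\frac{\sqrt{n+1-\bigl(\sum_{j=1}^{n+1}a_j\bigr)^2}}{(n-1)!}\;\sum_{j:\,a_j>0}\frac1{a_j}\prod_{k\ne j}\frac{a_j}{a_j-a_k},$$ where in the product $k$ ranges over all indices in $\{1,\dots,n+1\}$ other than $j$. -/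

import Mathlib

open MeasureTheory

/-- The regular `n`-simplex `S` (side length `√2`) embedded in Euclidean `ℝ^(n+1)`:
the points with nonnegative coordinates summing to `1`. -/
def regularSimplex (n : ℕ) : Set (EuclideanSpace ℝ (Fin (n + 1))) :=
  {x | ∑ j, x j = 1 ∧ ∀ j, 0 ≤ x j}

/-- The translated hyperplane `H_a^t = {x | ⟨a, x⟩ = t}`. -/
def hyperplane {m : ℕ} (a : EuclideanSpace ℝ (Fin m)) (t : ℝ) :
    Set (EuclideanSpace ℝ (Fin m)) :=
  {x | inner ℝ a x = t}

/-! Let `E j` be independent standard exponential variables and `F` the density of `∑ j, a j * E j`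
at `0`. The formula comes from computing `F` in two ways.

Geometrically, since `‖a‖ = 1`, `F` is the integral of `exp (-∑ x j)` over the cone `C` where `a^⊥`
meets the positive orthant. By homogeneity this equals `n!` times the volume of `C ∩ {∑ x j ≤ 1}`
(`lintegral_exp_neg_cone`). That truncated cone has base `H_a ∩ S` and height `1 / ‖q‖`, where `q`
is the projection of `(1, …, 1)` to `a^⊥` and `‖q‖ ^ 2 = n + 1 - (∑ a j) ^ 2`. Hence `F = (n - 1)! *
vol (H_a ∩ S) / ‖q‖` (`euclideanHausdorffMeasure_cone_inter_le`).

Analytically, `F` is an iterated convolution of exponential densities, which partial fractions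
evaluate as `expSumDensity` at `0` (`lintegral_prod_cutoff_mul_cutoff`). The two are matched in the
coordinates `x k`, `k ≠ p`, on `a^⊥`, for some `p` with `0 < a p`. -/

/-! ### Partial fractions and elementary exponential integrals -/

open Finset in
/-- Lagrange interpolation of `X` at the nodes `(α j)⁻¹`, evaluated at `0`. -/
theorem sum_inv_mul_prod_div_sub_eq_zero {κ : Type*} [DecidableEq κ] (α : κ → ℝ) (S : Finset κ)
    (hcard : 2 ≤ #S) (hinj : Set.InjOn α S) (hne : ∀ j ∈ S, α j ≠ 0) :
    ∑ j ∈ S, 1 / α j * ∏ k ∈ S.erase j, α j / (α j - α k) = 0 := by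
  have hinj' : Set.InjOn (fun j => (α j)⁻¹) S := fun i hi j hj h => hinj hi hj (inv_injective h)
  have hdeg : (Polynomial.X : Polynomial ℝ).degree < #S := by
    rw [Polynomial.degree_X]; exact_mod_cast hcard
  have h := congrArg (Polynomial.eval 0) (Lagrange.eq_interpolate hinj' hdeg)
  rw [Polynomial.eval_X, Lagrange.interpolate_apply, Polynomial.eval_finsetSum] at h
  rw [h]
  refine sum_congr rfl fun j hj => ?_
  simp only [Polynomial.eval_mul, Polynomial.eval_C, Polynomial.eval_X, Lagrange.basis,
    Polynomial.eval_prod, one_div]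
  congr 1
  refine prod_congr rfl fun k hk => ?_
  have hk' := mem_erase.1 hk
  have h1 : α j - α k ≠ 0 := sub_ne_zero.2 fun e => hk'.1 (hinj hk'.2 hj e.symm)
  have h2 := hne j hj
  have h3 := hne k hk'.2
  have h4 : (α j)⁻¹ - (α k)⁻¹ ≠ 0 := by
    rw [inv_sub_inv h2 h3]; exact div_ne_zero (by rwa [← neg_sub, neg_ne_zero]) (mul_ne_zero h2 h3)
  simp only [Lagrange.basisDivisor, Polynomial.eval_mul, Polynomial.eval_C, Polynomial.eval_sub,
    Polynomial.eval_X]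
  rw [div_eq_iff h1]
  field_simp
  have h5 : α k - α j ≠ 0 := by rwa [← neg_sub, neg_ne_zero]
  field_simp
  ring

theorem hasDerivAt_exp_mul_exp {α β : ℝ} (hα : α ≠ 0) (h : α ≠ β) (u t : ℝ) :
    HasDerivAt (fun t => α / (β - α) * (Real.exp (-t) * Real.exp (-(u - β * t) / α)))
      (Real.exp (-t) * Real.exp (-(u - β * t) / α)) t := by
  have h1 : HasDerivAt (fun t => Real.exp (-t)) (Real.exp (-t) * (-1)) t :=
    (hasDerivAt_id t).neg.exp
  have h2 : HasDerivAt (fun t => Real.exp (-(u - β * t) / α))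
      (Real.exp (-(u - β * t) / α) * (-(-(β * 1)) / α)) t :=
    ((((hasDerivAt_id t).const_mul β).const_sub u).neg.div_const α).exp
  refine ((h1.mul h2).const_mul (α / (β - α))).congr_deriv ?_
  have h3 : β - α ≠ 0 := sub_ne_zero.2 h.symm
  field_simp
  ring

/-- The range of integration stops at `u / β`, where the argument `u - β * t` of the one-sided
density reaches `0`. -/
theorem integral_exp_mul_exp {α β : ℝ} (hα : α ≠ 0) (hβ : β ≠ 0) (h : α ≠ β) (u : ℝ) :
    ∫ t in (0 : ℝ)..u / β, Real.exp (-t) * Real.exp (-(u - β * t) / α) =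
      α / (α - β) * (Real.exp (-u / α) - Real.exp (-u / β)) := by
  rw [intervalIntegral.integral_eq_sub_of_hasDerivAt
    (fun t _ => hasDerivAt_exp_mul_exp hα h u t) (Continuous.intervalIntegrable (by fun_prop) _ _)]
  rw [mul_div_cancel₀ _ hβ]
  have h3 : β - α ≠ 0 := sub_ne_zero.2 h.symm
  have h4 : α - β ≠ 0 := sub_ne_zero.2 h
  simp only [sub_self, neg_zero, zero_div, Real.exp_zero, mul_zero, sub_zero, mul_one, one_mul]
  rw [show -(u / β) = -u / β by ring]
  field_simp
  ring

theorem exp_mul_exp_eq {α : ℝ} (β u t : ℝ) :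
    Real.exp (-t) * Real.exp (-(u - β * t) / α) =
      Real.exp (-u / α) * Real.exp ((β / α - 1) * t) := by
  rw [← Real.exp_add, ← Real.exp_add]; congr 1; ring

theorem integrableOn_exp_mul_exp {α β : ℝ} (hα : 0 < α) (hβ : β ≤ 0) (u : ℝ) :
    IntegrableOn (fun t => Real.exp (-t) * Real.exp (-(u - β * t) / α)) (Set.Ioi 0) := by
  simp_rw [exp_mul_exp_eq]
  exact (integrableOn_exp_mul_Ioi (by have := div_nonpos_of_nonpos_of_nonneg hβ hα.le; linarith)
    0).const_mul _

theorem integral_Ioi_exp_mul_exp {α β : ℝ} (hα : 0 < α) (hβ : β ≤ 0) (u : ℝ) :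
    ∫ t in Set.Ioi (0 : ℝ), Real.exp (-t) * Real.exp (-(u - β * t) / α) =
      α / (α - β) * Real.exp (-u / α) := by
  have h0 : β / α - 1 < 0 := by have := div_nonpos_of_nonpos_of_nonneg hβ hα.le; linarith
  simp_rw [exp_mul_exp_eq]
  rw [integral_const_mul, integral_exp_mul_Ioi h0, mul_zero, Real.exp_zero]
  have : α - β ≠ 0 := by linarith
  have : β - α ≠ 0 := by linarith
  rw [show β / α - 1 = (β - α) / α by field_simp]
  field_simp
  ring

/-! ### Density of a weighted sum of exponential variables -/

/-- For `E j` independent standard exponential variables and positive weights with distinct values,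
the density of `∑ j ∈ S, a j * E j` at `u ≥ 0`; non-positive weights are allowed. -/
noncomputable def expSumDensity {κ : Type*} [DecidableEq κ] (a : κ → ℝ) (S : Finset κ) (u : ℝ) :
    ℝ :=
  ∑ j ∈ S.filter (fun j => 0 < a j),
    1 / a j * (∏ k ∈ S.erase j, a j / (a j - a k)) * Real.exp (-u / a j)

section
variable {κ : Type*} [DecidableEq κ] (a : κ → ℝ) (S : Finset κ)

@[fun_prop]
theorem continuous_expSumDensity : Continuous (expSumDensity a S) := by
  unfold expSumDensity; fun_prop

theorem erase_insert_prod {i j : κ} (hi : i ∉ S) (hj : j ∈ S) :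
    ∏ k ∈ (insert i S).erase j, a j / (a j - a k) =
      a j / (a j - a i) * ∏ k ∈ S.erase j, a j / (a j - a k) := by
  rw [Finset.erase_insert_of_ne (by rintro rfl; exact hi hj), Finset.prod_insert (by simp [hi])]

/-- Each old exponential acquires the factor `a j / (a j - a i)` and also contributes to `exp (-u /
a i)`. The interpolation identity says that these contributions add up to the coefficient of the new
term. -/
theorem integral_exp_mul_expSumDensity_of_pos {i : κ} (hi : i ∉ S) (hS : S.Nonempty)
    (hpos : ∀ j ∈ insert i S, 0 < a j) (hinj : Set.InjOn a (insert i S : Finset κ)) (u : ℝ) :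
    ∫ t in (0 : ℝ)..u / a i, Real.exp (-t) * expSumDensity a S (u - a i * t) =
      expSumDensity a (insert i S) u := by
  have hposS : ∀ j ∈ S, 0 < a j := fun j hj => hpos j (Finset.mem_insert_of_mem hj)
  have hposi : 0 < a i := hpos i (Finset.mem_insert_self i S)
  have hid := sum_inv_mul_prod_div_sub_eq_zero a (insert i S)
    (by rw [Finset.card_insert_of_notMem hi]; have := hS.card_pos; omega) hinj
    fun j hj => (hpos j hj).ne'
  unfold expSumDensity
  rw [Finset.filter_true_of_mem hposS, Finset.filter_true_of_mem hpos]
  rw [Finset.sum_insert hi] at hid ⊢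
  have h1 : ∀ t, Real.exp (-t) * ∑ j ∈ S, 1 / a j * (∏ k ∈ S.erase j, a j / (a j - a k)) *
        Real.exp (-(u - a i * t) / a j) =
      ∑ j ∈ S, 1 / a j * (∏ k ∈ S.erase j, a j / (a j - a k)) *
        (Real.exp (-t) * Real.exp (-(u - a i * t) / a j)) := fun t => by
    rw [Finset.mul_sum]; exact Finset.sum_congr rfl fun j _ => by ring
  simp_rw [h1]
  rw [intervalIntegral.integral_finsetSum fun j _ =>
    Continuous.intervalIntegrable (by fun_prop) _ _]
  -- The coefficient of `exp (-u / a i)` becomes minus the sum of the others, so both sides can be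
  -- compared term by term over `S`.
  rw [eq_neg_of_add_eq_zero_left hid, neg_mul, Finset.sum_mul, ← Finset.sum_neg_distrib,
    ← Finset.sum_add_distrib]
  refine Finset.sum_congr rfl fun j hj => ?_
  have hne : a j ≠ a i := fun e =>
    hi (hinj (Finset.mem_insert_of_mem hj) (Finset.mem_insert_self i S) e ▸ hj)
  rw [intervalIntegral.integral_const_mul,
    integral_exp_mul_exp (hposS j hj).ne' hposi.ne' hne, erase_insert_prod a S hi hj]
  ring

theorem filter_insert_of_nonpos {i : κ} (hai : a i ≤ 0) :
    (insert i S).filter (fun j => 0 < a j) = S.filter (fun j => 0 < a j) := by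
  rw [Finset.filter_insert, if_neg hai.not_gt]

theorem integrableOn_exp_mul_expSumDensity_of_nonpos {i : κ} (hai : a i ≤ 0) (u : ℝ) :
    IntegrableOn (fun t => Real.exp (-t) * expSumDensity a S (u - a i * t)) (Set.Ioi 0) := by
  unfold expSumDensity
  simp_rw [Finset.mul_sum]
  refine integrable_finsetSum _ fun j hj => ?_
  refine ((integrableOn_exp_mul_exp (Finset.mem_filter.1 hj).2 hai u).const_mul
    (1 / a j * ∏ k ∈ S.erase j, a j / (a j - a k))).congr (Filter.Eventually.of_forall fun t => ?_)
  ring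

/-- For `a i ≤ 0` and `u ≥ 0` the argument `u - a i * t` never leaves the half-line where the
density formula is valid. There is no upper boundary term, hence no new exponential, and
non-positive weights may coincide. -/
theorem integral_exp_mul_expSumDensity_of_nonpos {i : κ} (hi : i ∉ S) (hai : a i ≤ 0) (u : ℝ) :
    ∫ t in Set.Ioi (0 : ℝ), Real.exp (-t) * expSumDensity a S (u - a i * t) =
      expSumDensity a (insert i S) u := by
  unfold expSumDensity
  have h1 : ∀ t, Real.exp (-t) * ∑ j ∈ S.filter (fun j => 0 < a j),
        1 / a j * (∏ k ∈ S.erase j, a j / (a j - a k)) * Real.exp (-(u - a i * t) / a j) =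
      ∑ j ∈ S.filter (fun j => 0 < a j), 1 / a j * (∏ k ∈ S.erase j, a j / (a j - a k)) *
        (Real.exp (-t) * Real.exp (-(u - a i * t) / a j)) := fun t => by
    rw [Finset.mul_sum]; exact Finset.sum_congr rfl fun j _ => by ring
  simp_rw [h1]
  rw [filter_insert_of_nonpos a S hai, integral_finsetSum _ fun j hj =>
    (integrableOn_exp_mul_exp (Finset.mem_filter.1 hj).2 hai u).const_mul _]
  refine Finset.sum_congr rfl fun j hj => ?_
  rw [integral_const_mul, integral_Ioi_exp_mul_exp (Finset.mem_filter.1 hj).2 hai,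
    erase_insert_prod a S hi (Finset.mem_filter.1 hj).1]
  ring

end

/-! ### Iterated convolution as a lower Lebesgue integral -/

/-- The function `f` cut off to `0` on the negative half-line. -/
noncomputable def cutoff (f : ℝ → ℝ) (t : ℝ) : ENNReal :=
  if 0 ≤ t then ENNReal.ofReal (f t) else 0

theorem measurable_cutoff {f : ℝ → ℝ} (hf : Measurable f) : Measurable (cutoff f) :=
  Measurable.ite measurableSet_Ici hf.ennreal_ofReal measurable_const

theorem lintegral_cutoff_mul (f : ℝ → ℝ) (g : ℝ → ENNReal) :
    ∫⁻ t, cutoff f t * g t = ∫⁻ t in Set.Ioi 0, ENNReal.ofReal (f t) * g t := by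
  rw [setLIntegral_congr Ioi_ae_eq_Ici, ← lintegral_indicator measurableSet_Ici]
  refine lintegral_congr fun t => ?_
  by_cases h : 0 ≤ t <;> simp [cutoff, h]

section
variable {κ ι : Type*} [DecidableEq κ] [Fintype ι] [DecidableEq ι] (a : κ → ℝ)

/-- One-variable exponential convolution against a positive weight. -/
theorem lintegral_cutoff_mul_of_pos {S : Finset κ} {i : κ} (hi : i ∉ S) (hS : S.Nonempty)
    (hpos : ∀ j ∈ insert i S, 0 < a j) (hinj : Set.InjOn a (insert i S : Finset κ))
    {g : ℝ → ENNReal} (hg : ∀ u, g u = cutoff (expSumDensity a S) u)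
    (hD : ∀ u, 0 ≤ u → 0 ≤ expSumDensity a S u) (u : ℝ) :
    (∫⁻ t, cutoff (fun t => Real.exp (-t)) t * g (u - a i * t) =
      cutoff (expSumDensity a (insert i S)) u) ∧
    (0 ≤ u → 0 ≤ expSumDensity a (insert i S) u) := by
  have hai : 0 < a i := hpos i (Finset.mem_insert_self i S)
  rw [lintegral_cutoff_mul]
  by_cases hu : 0 ≤ u
  · have hnn : ∀ t ∈ Set.Ioc 0 (u / a i),
        0 ≤ Real.exp (-t) * expSumDensity a S (u - a i * t) := fun t ht =>
      mul_nonneg (Real.exp_pos _).le <| hD _ <| by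
        have := (le_div_iff₀ hai).1 ht.2
        linarith [mul_comm t (a i)]
    have hint := integral_exp_mul_expSumDensity_of_pos a S hi hS hpos hinj u
    rw [intervalIntegral.integral_of_le (by positivity)] at hint
    -- Nonnegativity is not visible from the signed sum; it is inherited through the convolution
    -- integral.
    refine ⟨?_, fun _ => hint ▸ setIntegral_nonneg measurableSet_Ioc hnn⟩
    rw [cutoff, if_pos hu, ← hint, ofReal_integral_eq_lintegral_ofReal
      ((Continuous.integrableOn_Icc (by fun_prop)).mono_set Set.Ioc_subset_Icc_self)
      ((ae_restrict_iff' measurableSet_Ioc).2 (Filter.Eventually.of_forall hnn))]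
    rw [← lintegral_indicator measurableSet_Ioi, ← lintegral_indicator measurableSet_Ioc]
    refine lintegral_congr fun t => ?_
    by_cases h0 : 0 < t
    · by_cases h1 : t ≤ u / a i
      · have : 0 ≤ u - a i * t := by
          have := (le_div_iff₀ hai).1 h1
          linarith [mul_comm t (a i)]
        simp [Set.indicator, h0, h1, hg, cutoff, this, ENNReal.ofReal_mul, (Real.exp_pos _).le]
      · have : ¬ 0 ≤ u - a i * t := by
          have := (div_lt_iff₀ hai).1 (not_le.1 h1)
          linarith [mul_comm t (a i)]
        simp [Set.indicator, h1, hg, cutoff, this]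
    · simp [Set.indicator, h0]
  · refine ⟨?_, fun h => absurd h hu⟩
    rw [cutoff, if_neg hu]
    refine (setLIntegral_congr_fun measurableSet_Ioi fun t ht => ?_).trans lintegral_zero
    have : ¬ 0 ≤ u - a i * t := by
      have := mul_pos hai (Set.mem_Ioi.1 ht)
      linarith
    simp [hg, cutoff, this]

/-- One-variable exponential convolution against a non-positive weight. -/
theorem lintegral_cutoff_mul_of_nonpos {S : Finset κ} {i : κ} (hi : i ∉ S) (hai : a i ≤ 0)
    {g : ℝ → ENNReal} (hg : ∀ u, 0 ≤ u → g u = ENNReal.ofReal (expSumDensity a S u))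
    (hD : ∀ u, 0 ≤ u → 0 ≤ expSumDensity a S u) (u : ℝ) (hu : 0 ≤ u) :
    (∫⁻ t, cutoff (fun t => Real.exp (-t)) t * g (u - a i * t) =
      ENNReal.ofReal (expSumDensity a (insert i S) u)) ∧
    0 ≤ expSumDensity a (insert i S) u := by
  have harg : ∀ t ∈ Set.Ioi (0 : ℝ), 0 ≤ u - a i * t := fun t ht => by
    have := mul_nonpos_of_nonpos_of_nonneg hai (Set.mem_Ioi.1 ht).le
    linarith
  have hnn : ∀ t ∈ Set.Ioi (0 : ℝ), 0 ≤ Real.exp (-t) * expSumDensity a S (u - a i * t) :=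
    fun t ht => mul_nonneg (Real.exp_pos _).le (hD _ (harg t ht))
  have hint := integral_exp_mul_expSumDensity_of_nonpos a S hi hai u
  refine ⟨?_, hint ▸ setIntegral_nonneg measurableSet_Ioi hnn⟩
  rw [lintegral_cutoff_mul, ← hint, ofReal_integral_eq_lintegral_ofReal
    (integrableOn_exp_mul_expSumDensity_of_nonpos a S hai u)
    ((ae_restrict_iff' measurableSet_Ioi).2 (Filter.Eventually.of_forall hnn))]
  refine setLIntegral_congr_fun measurableSet_Ioi fun t ht => ?_
  simp only [hg _ (harg t ht)]
  rw [ENNReal.ofReal_mul (Real.exp_pos _).le]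

/-- Integrating out one more variable of a product density composed with a linear form. -/
theorem lmarginal_insert_prod_mul {w : ℝ → ENNReal} {b : ι → ℝ} {h : (ι → ℝ) → ENNReal}
    (hh : Measurable h) {s : Finset ι} {g : ℝ → ENNReal} {i : ι} (hi : i ∉ s)
    (hw : Measurable w) (hg : Measurable g)
    (hs : ∀ x, (∫⋯∫⁻_s, h ∂fun _ => volume) x =
      (∏ k ∈ sᶜ, w (x k)) * g (-∑ k ∈ sᶜ, b k * x k)) (x : ι → ℝ) :
    (∫⋯∫⁻_insert i s, h ∂fun _ => volume) x =
      (∏ k ∈ (insert i s)ᶜ, w (x k)) *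
        ∫⁻ t, w t * g ((-∑ k ∈ (insert i s)ᶜ, b k * x k) - b i * t) := by
  rw [lmarginal_insert h hh hi]
  have hc : sᶜ = insert i (insert i s)ᶜ := by
    rw [Finset.compl_insert, Finset.insert_erase (by simpa using hi)]
  have hic : i ∉ (insert i s)ᶜ := by simp
  have hup : ∀ t, ∀ k ∈ (insert i s)ᶜ, Function.update x i t k = x k := fun t k hk =>
    Function.update_of_ne (by rintro rfl; exact hic hk) _ _
  rw [← lintegral_const_mul _ (by fun_prop)]
  refine lintegral_congr fun t => ?_
  rw [hs, hc, Finset.prod_insert hic, Finset.sum_insert hic, Function.update_self,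
    Finset.prod_congr rfl fun k hk => by rw [hup t k hk],
    Finset.sum_congr rfl fun k hk => by rw [hup t k hk], neg_add, neg_add_eq_sub]
  ring

end

section
variable {κ ι : Type*} [DecidableEq κ] [Fintype ι] [DecidableEq ι] (a : κ → ℝ)

/-- The density of `a p * E p + ∑ k, a (e k) * E k` at `0` as an iterated integral, where the `E`
are independent standard exponential variables. -/
theorem lintegral_prod_cutoff_mul_cutoff (e : ι ↪ κ) {p : κ} (hp : 0 < a p)
    (hpe : ∀ k, e k ≠ p) (hinj : ∀ i j, 0 < a i → 0 < a j → i ≠ j → a i ≠ a j) :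
    (∫⁻ y : ι → ℝ, (∏ k, cutoff (fun t => Real.exp (-t)) (y k)) *
        cutoff (expSumDensity a {p}) (-∑ k, a (e k) * y k)) =
      ENNReal.ofReal (expSumDensity a (insert p (Finset.univ.map e)) 0) ∧
    0 ≤ expSumDensity a (insert p (Finset.univ.map e)) 0 := by
  set w := cutoff fun t => Real.exp (-t) with hw_def
  have hw : Measurable w := measurable_cutoff (by fun_prop)
  have hΦ : Measurable (cutoff (expSumDensity a {p})) :=
    measurable_cutoff (continuous_expSumDensity a {p}).measurable
  set h : (ι → ℝ) → ENNReal := fun y =>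
    (∏ k, w (y k)) * cutoff (expSumDensity a {p}) (-∑ k, a (e k) * y k) with h_def
  have hh : Measurable h := by fun_prop
  have hins : ∀ (s : Finset ι) i, insert p ((insert i s).map e) = insert (e i) (insert p (s.map e)) :=
    fun s i => by rw [Finset.map_insert, Finset.insert_comm]
  have hnot : ∀ (s : Finset ι) i, i ∉ s → e i ∉ insert p (s.map e) := fun s i hi => by
    simp [hpe i, hi]
  set P : Finset ι := Finset.univ.filter fun k => 0 < a (e k) with hP
  have hposP : ∀ s : Finset ι, s ⊆ P → ∀ j ∈ insert p (s.map e), 0 < a j := fun s hs j hj => by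
    rcases Finset.mem_insert.1 hj with rfl | hj
    · exact hp
    · obtain ⟨k, hk, rfl⟩ := Finset.mem_map.1 hj
      exact (Finset.mem_filter.1 (hs hk)).2
  have hinjP : ∀ s : Finset ι, s ⊆ P → Set.InjOn a (insert p (s.map e) : Finset κ) :=
    fun s hs i hi j hj hij => by
      by_contra hne
      exact hinj i j (hposP s hs i hi) (hposP s hs j hj) hne hij
  -- Positive weights are integrated out first: the partial sums are then supported on `u ≥ 0`, so
  -- the cut-off formula holds for every `u`.
  have step1 : ∀ s : Finset ι, s ⊆ P →
      (∀ x, (∫⋯∫⁻_s, h ∂fun _ => volume) x =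
        (∏ k ∈ sᶜ, w (x k)) * cutoff (expSumDensity a (insert p (s.map e)))
          (-∑ k ∈ sᶜ, a (e k) * x k)) ∧
      ∀ u, 0 ≤ u → 0 ≤ expSumDensity a (insert p (s.map e)) u := by
    intro s
    induction s using Finset.induction_on with
    | empty =>
      refine fun _ => ⟨fun x => by simp [h_def], fun u _ => ?_⟩
      simp only [Finset.map_empty, insert_empty_eq, expSumDensity]
      rw [Finset.filter_true_of_mem (by simpa using hp)]
      simp only [Finset.sum_singleton, Finset.erase_singleton, Finset.prod_empty]
      positivity
    | insert i s hi ih =>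
      intro hsub
      obtain ⟨ih1, ih2⟩ := ih ((Finset.subset_insert i s).trans hsub)
      have key := lintegral_cutoff_mul_of_pos a (hnot s i hi) (Finset.insert_nonempty _ _)
        (hins s i ▸ hposP _ hsub) (hins s i ▸ hinjP _ hsub) (fun u => rfl) ih2
      rw [hins]
      refine ⟨fun x => ?_, fun u => (key u).2⟩
      rw [lmarginal_insert_prod_mul hh hi hw
        (measurable_cutoff (continuous_expSumDensity a _).measurable) ih1, (key _).1]
  -- Once a negative weight enters, the density also lives on `u < 0`, where the formula need not
  -- hold. So `g` is only specified for `u ≥ 0`, which suffices because the remaining weights move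
  -- the argument to the right.
  have step2 : ∀ r : Finset ι, Disjoint P r →
      ∃ g : ℝ → ENNReal, Measurable g ∧
      (∀ x, (∫⋯∫⁻_(P ∪ r), h ∂fun _ => volume) x =
        (∏ k ∈ (P ∪ r)ᶜ, w (x k)) * g (-∑ k ∈ (P ∪ r)ᶜ, a (e k) * x k)) ∧
      (∀ u, 0 ≤ u → g u = ENNReal.ofReal (expSumDensity a (insert p ((P ∪ r).map e)) u)) ∧
      ∀ u, 0 ≤ u → 0 ≤ expSumDensity a (insert p ((P ∪ r).map e)) u := by
    intro r
    induction r using Finset.induction_on with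
    | empty =>
      intro _
      obtain ⟨h1, h2⟩ := step1 P subset_rfl
      rw [Finset.union_empty]
      exact ⟨_, measurable_cutoff (continuous_expSumDensity a _).measurable, h1,
        fun u hu => if_pos hu, h2⟩
    | insert i r hi ih =>
      intro hdis
      rw [Finset.disjoint_insert_right] at hdis
      obtain ⟨g, hg, ih1, ih2, ih3⟩ := ih hdis.2
      have hi' : i ∉ P ∪ r := by simp only [Finset.mem_union]; tauto
      have hai : a (e i) ≤ 0 := by
        have := hdis.1
        simpa [hP] using this
      have key := lintegral_cutoff_mul_of_nonpos a (hnot _ i hi') hai ih2 ih3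
      rw [Finset.union_insert, hins]
      refine ⟨fun u => ∫⁻ t, w t * g (u - a (e i) * t), ?_, fun x => ?_,
        fun u hu => (key u hu).1, fun u hu => (key u hu).2⟩
      · exact Measurable.lintegral_prod_right' (f := fun q : ℝ × ℝ => w q.2 * g (q.1 - a (e i) * q.2))
          (by fun_prop)
      · exact lmarginal_insert_prod_mul hh hi' hw hg ih1 x
  obtain ⟨g, -, h1, h2, h3⟩ := step2 Pᶜ disjoint_compl_right
  rw [Finset.union_compl] at h1 h2 h3
  refine ⟨?_, h3 0 le_rfl⟩
  have := h1 0
  rw [lmarginal_univ] at this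
  simp only [Finset.compl_univ, Finset.prod_empty, Finset.sum_empty, neg_zero, one_mul,
    h2 0 le_rfl] at this
  exact this

end

/-! ### Exponential integrals and volumes of cones -/

open Module Pointwise in
/-- Integral of `exp (-l)` over a cone on which the linear form `l` is nonnegative. -/
theorem lintegral_exp_neg_cone {E : Type*} [NormedAddCommGroup E] [NormedSpace ℝ E]
    [FiniteDimensional ℝ E] [MeasurableSpace E] [BorelSpace E] (μ : Measure E) [μ.IsAddHaarMeasure]
    {C : Set E} (hC : MeasurableSet C) (hcone : ∀ r : ℝ, 0 < r → ∀ y ∈ C, r • y ∈ C)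
    (l : E →L[ℝ] ℝ) (hl : ∀ y ∈ C, 0 ≤ l y) :
    ∫⁻ y in C, ENNReal.ofReal (Real.exp (-l y)) ∂μ =
      ((finrank ℝ E).factorial : ENNReal) * μ (C ∩ {y | l y ≤ 1}) := by
  set d := finrank ℝ E
  have hlm : Measurable l := l.continuous.measurable
  -- Layer-cake form of `exp (-c)`: after Tonelli only the volumes of the sublevel sets `l ≤ r`
  -- matter, and these scale as `r ^ d`.
  have hexp : ∀ c : ℝ, 0 ≤ c → ENNReal.ofReal (Real.exp (-c)) =
      ∫⁻ r in Set.Ioi (0 : ℝ), (if c ≤ r then 1 else 0) * ENNReal.ofReal (Real.exp (-r)) := by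
    intro c hc
    have hint : IntegrableOn (fun r : ℝ => Real.exp (-r)) (Set.Ioi c) := by
      simpa using integrableOn_exp_mul_Ioi (a := -1) (by norm_num) c
    rw [← integral_exp_neg_Ioi c, ofReal_integral_eq_lintegral_ofReal hint
      (Filter.Eventually.of_forall fun r => (Real.exp_pos _).le),
      setLIntegral_congr Ioi_ae_eq_Ici, setLIntegral_congr (Ioi_ae_eq_Ici (a := (0 : ℝ))),
      ← lintegral_indicator measurableSet_Ici, ← lintegral_indicator measurableSet_Ici]
    refine lintegral_congr fun r => ?_
    by_cases h : c ≤ r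
    · simp [Set.indicator, h, hc.trans h]
    · simp [Set.indicator, h]
  have hscale : ∀ r : ℝ, 0 < r →
      μ (C ∩ {y | l y ≤ r}) = ENNReal.ofReal (r ^ d) * μ (C ∩ {y | l y ≤ 1}) := by
    intro r hr
    have hset : C ∩ {y | l y ≤ r} = r • (C ∩ {y | l y ≤ 1}) := by
      ext y
      rw [Set.mem_smul_set_iff_inv_smul_mem₀ hr.ne']
      simp only [Set.mem_inter_iff, Set.mem_ofPred_eq, map_smul, smul_eq_mul, inv_mul_le_iff₀ hr,
        mul_one]
      refine and_congr_left fun _ => ⟨hcone _ (inv_pos.2 hr) y, fun h => ?_⟩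
      simpa [smul_smul, hr.ne'] using hcone r hr _ h
    rw [hset, Measure.addHaar_smul, abs_of_pos (pow_pos hr _)]
  calc ∫⁻ y in C, ENNReal.ofReal (Real.exp (-l y)) ∂μ
      = ∫⁻ y in C, (∫⁻ r in Set.Ioi (0 : ℝ),
          (if l y ≤ r then 1 else 0) * ENNReal.ofReal (Real.exp (-r))) ∂μ :=
        setLIntegral_congr_fun hC fun y hy => hexp _ (hl y hy)
    _ = ∫⁻ r in Set.Ioi (0 : ℝ), ∫⁻ y in C,
          (if l y ≤ r then 1 else 0) * ENNReal.ofReal (Real.exp (-r)) ∂μ := by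
        refine lintegral_lintegral_swap (Measurable.aemeasurable ?_)
        refine Measurable.mul (Measurable.ite ?_ measurable_const measurable_const) (by fun_prop)
        exact measurableSet_le (by fun_prop) (by fun_prop)
    _ = ∫⁻ r in Set.Ioi (0 : ℝ),
          ENNReal.ofReal (Real.exp (-r) * r ^ d) * μ (C ∩ {y | l y ≤ 1}) := by
        refine setLIntegral_congr_fun measurableSet_Ioi fun r hr => ?_
        have hm : MeasurableSet {y | l y ≤ r} := measurableSet_le hlm measurable_const
        have : ∀ y, (if l y ≤ r then (1 : ENNReal) else 0) = {y | l y ≤ r}.indicator 1 y :=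
          fun y => by simp [Set.indicator]
        simp only [this]
        rw [lintegral_mul_const _ (measurable_one.indicator hm), lintegral_indicator_one hm,
          Measure.restrict_apply hm, Set.inter_comm, hscale r hr,
          ENNReal.ofReal_mul (Real.exp_pos _).le]
        ring
    _ = (d.factorial : ENNReal) * μ (C ∩ {y | l y ≤ 1}) := by
        rw [lintegral_mul_const _ (by fun_prop)]
        congr 1
        have hG := Real.GammaIntegral_convergent (s := (d : ℝ) + 1) (by positivity)
        have hGe := Real.Gamma_eq_integral (s := (d : ℝ) + 1) (by positivity)
        simp only [add_sub_cancel_right, Real.rpow_natCast] at hG hGe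
        rw [Real.Gamma_nat_eq_factorial] at hGe
        rw [← ofReal_integral_eq_lintegral_ofReal hG, ← hGe, ENNReal.ofReal_natCast]
        refine (ae_restrict_iff' measurableSet_Ioi).2 (Filter.Eventually.of_forall fun r hr => ?_)
        have := Set.mem_Ioi.1 hr
        simp only [Pi.zero_apply]
        positivity

open Module Pointwise in
/-- Volume of a truncated cone in terms of its base. -/
theorem euclideanHausdorffMeasure_cone_inter_le {V : Type*} [NormedAddCommGroup V]
    [InnerProductSpace ℝ V] [FiniteDimensional ℝ V] [MeasurableSpace V] [BorelSpace V]
    {C : Set V} (hC : MeasurableSet C) (hcone : ∀ r : ℝ, 0 < r → ∀ y ∈ C, r • y ∈ C)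
    {q : V} (hq : q ≠ 0) (hl : ∀ y ∈ C, 0 ≤ inner ℝ q y) :
    μHE[finrank ℝ V] (C ∩ {y | inner ℝ q y ≤ 1}) =
      ENNReal.ofReal (‖q‖⁻¹ / finrank ℝ V) *
        μHE[finrank ℝ V - 1] (C ∩ {y | inner ℝ q y = 1}) := by
  set d := finrank ℝ V
  have hd : 0 < d := by
    have : Nontrivial V := ⟨⟨q, 0, hq⟩⟩
    exact finrank_pos
  have hqn : ‖q‖ ≠ 0 := norm_ne_zero_iff.2 hq
  -- Normalised so that `inner ℝ q v = 1`: the slice through `x • v` orthogonal to `v` is the level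
  -- set `inner ℝ q y = x`, and `‖v‖ = ‖q‖⁻¹` is the height of the cone.
  set v : V := (‖q‖ ^ 2)⁻¹ • q with hv_def
  have hv : v ≠ 0 := smul_ne_zero (inv_ne_zero (pow_ne_zero 2 hqn)) hq
  have hqv : inner ℝ q v = 1 := by
    rw [hv_def, inner_smul_right, real_inner_self_eq_norm_sq]
    exact inv_mul_cancel₀ (pow_ne_zero 2 hqn)
  have hvn : ‖v‖ = ‖q‖⁻¹ := by
    rw [hv_def, norm_smul, norm_inv, norm_pow, norm_norm]; field_simp
  have hmeas : MeasurableSet (C ∩ {y | inner ℝ q y ≤ 1}) :=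
    hC.inter (measurableSet_le (by fun_prop) measurable_const)
  have hmem : ∀ (x : ℝ) (y : V),
      y ∈ AffineSubspace.mk' (x • v +ᵥ (0 : V)) (Submodule.span ℝ {v})ᗮ ↔ inner ℝ q y = x := by
    intro x y
    rw [AffineSubspace.mem_mk', Submodule.mem_orthogonal_singleton_iff_inner_right]
    simp only [vadd_eq_add, add_zero, vsub_eq_sub, inner_sub_right, inner_smul_right]
    rw [hv_def, inner_smul_left, inner_smul_left, ← hv_def, hqv]
    have : (‖q‖ ^ 2)⁻¹ ≠ 0 := inv_ne_zero (pow_ne_zero 2 hqn)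
    simp only [map_inv₀, map_pow, conj_trivial, mul_one, sub_eq_zero]
    rw [mul_comm x, mul_right_inj' this]
  have hslice : ∀ x : ℝ, x ≠ 0 →
      μHE[d - 1] (C ∩ {y | inner ℝ q y ≤ 1} ∩
        (AffineSubspace.mk' (x • v +ᵥ (0 : V)) (Submodule.span ℝ {v})ᗮ : Set V)) =
      (Set.Ioc (0 : ℝ) 1).indicator (fun x => ENNReal.ofReal (x ^ (d - 1)) *
        μHE[d - 1] (C ∩ {y | inner ℝ q y = 1})) x := by
    intro x hx
    by_cases hx1 : x ∈ Set.Ioc (0 : ℝ) 1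
    · have hr := hx1.1
      rw [Set.indicator_of_mem hx1]
      have hset : C ∩ {y | inner ℝ q y ≤ 1} ∩
          (AffineSubspace.mk' (x • v +ᵥ (0 : V)) (Submodule.span ℝ {v})ᗮ : Set V) =
          x • (C ∩ {y | inner ℝ q y = 1}) := by
        ext y
        rw [Set.mem_smul_set_iff_inv_smul_mem₀ hx]
        simp only [Set.mem_inter_iff, SetLike.mem_coe, hmem, Set.mem_ofPred_eq, inner_smul_right]
        rw [inv_mul_eq_one₀ hx]
        refine ⟨fun h => ⟨hcone _ (inv_pos.2 hr) y h.1.1, h.2.symm⟩, fun h => ⟨⟨?_, ?_⟩, h.2.symm⟩⟩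
        · simpa [smul_smul, hx] using hcone x hr _ h.1
        · rw [← h.2]; exact hx1.2
      rw [hset, Measure.euclideanHausdorffMeasure_smul₀ _ hx, ENNReal.smul_def, smul_eq_mul]
      congr 1
      rw [ENNReal.ofReal, ENNReal.coe_inj]
      ext
      simp [abs_of_pos hr, Real.coe_toNNReal _ (pow_nonneg hr.le _)]
    · rw [Set.indicator_of_notMem hx1]
      convert measure_empty (μ := (μHE[d - 1] : Measure V))
      refine Set.eq_empty_of_forall_notMem fun y hy => hx1 ?_
      have h1 := (hmem x y).1 hy.2
      exact ⟨lt_of_le_of_ne (h1 ▸ hl y hy.1.1) hx.symm, h1 ▸ hy.1.2⟩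
  rw [EuclideanGeometry.euclideanHausdorffMeasure_eq_lintegral (0 : V) hv hmeas,
    lintegral_congr_ae (g := (Set.Ioc (0 : ℝ) 1).indicator (fun x => ENNReal.ofReal (x ^ (d - 1)) *
        μHE[d - 1] (C ∩ {y | inner ℝ q y = 1})))
      ((Measure.ae_ne volume (0 : ℝ)).mono fun x hx => hslice x hx),
    lintegral_indicator measurableSet_Ioc, lintegral_mul_const _ (by fun_prop),
    ← ofReal_integral_eq_lintegral_ofReal
      ((Continuous.integrableOn_Icc (by fun_prop)).mono_set Set.Ioc_subset_Icc_self)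
      ((ae_restrict_iff' measurableSet_Ioc).2 (Filter.Eventually.of_forall fun x hx =>
        pow_nonneg hx.1.le _)),
    ← intervalIntegral.integral_of_le zero_le_one, integral_pow, ← mul_assoc, ← ofReal_norm,
    ← ENNReal.ofReal_mul (norm_nonneg _), hvn]
  have : ((d - 1 : ℕ) : ℝ) + 1 = d := by exact_mod_cast Nat.sub_add_cancel hd
  rw [Nat.sub_add_cancel hd, this]
  simp [div_eq_mul_inv, hd.ne']

/-! ### Graph coordinates on the hyperplane -/

/-- The parametrization of the graph `x p = ∑ k, β k * y k` over the other coordinates. -/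
noncomputable def graphMap {n : ℕ} (p : Fin (n + 1)) (β : Fin n → ℝ) :
    EuclideanSpace ℝ (Fin n) →ₗ[ℝ] EuclideanSpace ℝ (Fin (n + 1)) where
  toFun y := WithLp.toLp 2 (p.insertNth (α := fun _ => ℝ) (∑ k, β k * y k) fun k => y k)
  map_add' y z := by
    ext j
    refine Fin.succAboveCases p ?_ (fun k => ?_) j <;> simp [mul_add, Finset.sum_add_distrib]
  map_smul' c y := by
    ext j
    refine Fin.succAboveCases p ?_ (fun k => ?_) j <;> simp [Finset.mul_sum, mul_left_comm]

section
variable {n : ℕ} (p : Fin (n + 1)) (β : Fin n → ℝ)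

@[simp]
theorem graphMap_apply_self (y : EuclideanSpace ℝ (Fin n)) :
    graphMap p β y p = ∑ k, β k * y k := by
  simp [graphMap]

@[simp]
theorem graphMap_apply_succAbove (y : EuclideanSpace ℝ (Fin n)) (k : Fin n) :
    graphMap p β y (p.succAbove k) = y k := by
  simp [graphMap]

theorem mem_range_graphMap_iff (x : EuclideanSpace ℝ (Fin (n + 1))) :
    x p = ∑ k, β k * x (p.succAbove k) ↔
      graphMap p β (WithLp.toLp 2 fun k => x (p.succAbove k)) = x := by
  refine ⟨fun h => ?_, fun h => ?_⟩
  · ext j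
    refine Fin.succAboveCases p ?_ (fun k => ?_) j <;> simp [h]
  · have := congrArg (fun z : EuclideanSpace ℝ (Fin (n + 1)) => z p) h
    simpa using this.symm

/-- The Gram matrix of the images of the basis vectors is the rank-one perturbation `1 + β βᵀ`, with
determinant `1 + ∑ β k ^ 2`. -/
theorem normDet_graphMap : (graphMap p β).normDet = √(1 + ∑ k, β k ^ 2) := by
  have h := (graphMap p β).normDet_sq_eq_det_gram (EuclideanSpace.basisFun (Fin n) ℝ)
  have hg : Matrix.gram ℝ (fun k => graphMap p β (EuclideanSpace.basisFun (Fin n) ℝ k)) =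
      1 + Matrix.replicateCol Unit β * Matrix.replicateRow Unit β := by
    ext i j
    rw [Matrix.gram_apply, PiLp.inner_apply, Fin.sum_univ_succAbove _ p]
    simp [Matrix.one_apply, Matrix.mul_apply, add_comm, mul_comm, eq_comm]
  rw [hg, Matrix.det_one_add_replicateCol_mul_replicateRow] at h
  rw [eq_comm, Real.sqrt_eq_iff_eq_sq (by positivity) (LinearMap.normDet_nonneg _)]
  refine Eq.trans ?_ h.symm
  simp [dotProduct, sq]

end

section
variable {n : ℕ} {a : EuclideanSpace ℝ (Fin (n + 1))} {p : Fin (n + 1)}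

theorem inner_toLp_one (x : EuclideanSpace ℝ (Fin (n + 1))) :
    inner ℝ (WithLp.toLp 2 fun _ => (1 : ℝ)) x = ∑ j, x j := by
  simp [PiLp.inner_apply]

theorem inner_eq_zero_iff_mem_graph (hp : 0 < a p) (x : EuclideanSpace ℝ (Fin (n + 1))) :
    inner ℝ a x = 0 ↔ x p = ∑ k, -a (p.succAbove k) / a p * x (p.succAbove k) := by
  have h : ∑ k, -a (p.succAbove k) / a p * x (p.succAbove k) =
      -(∑ k, a (p.succAbove k) * x (p.succAbove k)) / a p := by
    rw [← Finset.sum_neg_distrib, Finset.sum_div]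
    exact Finset.sum_congr rfl fun k _ => by ring
  rw [h, PiLp.inner_apply, Fin.sum_univ_succAbove _ p, eq_div_iff hp.ne']
  simp only [RCLike.inner_apply, conj_trivial, mul_comm (x _)]
  constructor <;> intro h <;> linarith

theorem normDet_graphMap_neg_div (ha : ‖a‖ = 1) (hp : 0 < a p) :
    (graphMap p fun k => -a (p.succAbove k) / a p).normDet = (a p)⁻¹ := by
  have h : ∑ j, a j ^ 2 = 1 := by rw [← EuclideanSpace.real_norm_sq_eq, ha, one_pow]
  rw [Fin.sum_univ_succAbove _ p] at h
  rw [normDet_graphMap, Real.sqrt_eq_iff_eq_sq (by positivity) (by positivity)]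
  simp_rw [div_pow, neg_sq]
  rw [← Finset.sum_div, eq_sub_of_add_eq' h]
  field_simp
  ring

theorem sum_graphMap (β : Fin n → ℝ) (y : EuclideanSpace ℝ (Fin n)) :
    ∑ j, graphMap p β y j = ∑ k, β k * y k + ∑ k, y k := by
  rw [Fin.sum_univ_succAbove _ p]; simp

/-- The exponential integral over the orthant part of `a^⊥`, in the coordinates other than `p`. -/
theorem lintegral_exp_neg_sum_graphMap (hp : 0 < a p)
    (hdistinct : ∀ i j, 0 < a i → 0 < a j → i ≠ j → a i ≠ a j) :
    (∫⁻ y in {y | ∀ j, 0 ≤ graphMap p (fun k => -a (p.succAbove k) / a p) y j},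
        ENNReal.ofReal (Real.exp (-∑ j, graphMap p (fun k => -a (p.succAbove k) / a p) y j))) =
      ENNReal.ofReal (a p * expSumDensity a.ofLp Finset.univ 0) ∧
    0 ≤ expSumDensity a.ofLp Finset.univ 0 := by
  have huniv : insert p (Finset.univ.map p.succAboveEmb) = Finset.univ := by
    rw [Fin.univ_succAbove n p, Finset.cons_eq_insert]
  obtain ⟨h1, h2⟩ := lintegral_prod_cutoff_mul_cutoff a.ofLp p.succAboveEmb hp
    (fun k => Fin.succAbove_ne p k) hdistinct
  rw [huniv] at h1 h2
  refine ⟨?_, h2⟩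
  set L := graphMap p fun k => -a (p.succAbove k) / a p with hL
  have hLc : Continuous L := L.continuous_of_finiteDimensional
  have hD : MeasurableSet {y | ∀ j, 0 ≤ L y j} := by
    rw [Set.ofPred_forall]
    exact MeasurableSet.iInter fun j => measurableSet_le measurable_const
      (by fun_prop : Continuous fun y => L y j).measurable
  rw [ENNReal.ofReal_mul hp.le, ← h1, ← lintegral_const_mul' _ _ ENNReal.ofReal_ne_top,
    ← lintegral_indicator hD, ← (PiLp.volume_preserving_toLp (Fin n)).lintegral_comp_emb
      (MeasurableEquiv.toLp 2 (Fin n → ℝ)).measurableEmbedding]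
  refine lintegral_congr fun y => ?_
  -- On `a^⊥` the coordinate `x p` is `u / a p`. Its factor `exp (-x p)` is `a p` times the density
  -- of `a p * E p` at `u`, which explains the factor `a p` in the statement.
  set u := -∑ k, a (p.succAbove k) * y k with hu
  have hLp : ∑ k, -a (p.succAbove k) / a p * y k = u / a p := by
    rw [hu, ← Finset.sum_neg_distrib, Finset.sum_div]
    exact Finset.sum_congr rfl fun k _ => by ring
  have hiff : WithLp.toLp 2 y ∈ {y | ∀ j, 0 ≤ L y j} ↔ 0 ≤ u ∧ ∀ k, 0 ≤ y k := by
    rw [Set.mem_ofPred_eq, Fin.forall_iff_succAbove p]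
    simp [hL, hLp, div_nonneg_iff, hp.le, hp.not_ge]
  have hcut : ∀ k, 0 ≤ y k →
      cutoff (fun t => Real.exp (-t)) (y k) = ENNReal.ofReal (Real.exp (-y k)) :=
    fun k hk => if_pos hk
  have hdens : expSumDensity a.ofLp {p} u = (a p)⁻¹ * Real.exp (-u / a p) := by
    simp [expSumDensity, Finset.filter_singleton, hp]
  change Set.indicator _ _ _ = ENNReal.ofReal (a p) *
    ((∏ k, cutoff (fun t => Real.exp (-t)) (y k)) * cutoff (expSumDensity a.ofLp {p}) u)
  by_cases hy : ∀ k, 0 ≤ y k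
  · by_cases hu0 : 0 ≤ u
    · rw [Set.indicator_of_mem (hiff.2 ⟨hu0, hy⟩), Finset.prod_congr rfl fun k _ => hcut k (hy k),
        ← ENNReal.ofReal_prod_of_nonneg fun k _ => (Real.exp_pos _).le, ← Real.exp_sum, cutoff,
        if_pos hu0, hdens, ← ENNReal.ofReal_mul (Real.exp_pos _).le, ← ENNReal.ofReal_mul hp.le,
        hL, sum_graphMap]
      simp only [hLp]
      congr 1
      rw [neg_add, Real.exp_add, Finset.sum_neg_distrib, neg_div]
      field_simp
      rw [hu, neg_div, neg_neg]
    · rw [Set.indicator_of_notMem fun h => hu0 (hiff.1 h).1, cutoff.eq_def _ u, if_neg hu0]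
      simp
  · rw [Set.indicator_of_notMem fun h => hy (hiff.1 h).2]
    push Not at hy
    obtain ⟨k, hk⟩ := hy
    rw [Finset.prod_eq_zero (Finset.mem_univ k) (by simp [cutoff, hk])]
    simp

end

/-! ### Comparison of the two computations -/

theorem euclideanHausdorffMeasure_hyperplane_inter_regularSimplex {n : ℕ}
    {a : EuclideanSpace ℝ (Fin (n + 1))} (ha : ‖a‖ = 1)
    (hdistinct : ∀ i j, 0 < a i → 0 < a j → i ≠ j → a i ≠ a j)
    (hpos : ∃ j, 0 < a j) (hneg : ∃ j, a j < 0) :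
    μHE[n - 1] (hyperplane a 0 ∩ regularSimplex n) =
      ENNReal.ofReal (√((n : ℝ) + 1 - (∑ j, a j) ^ 2) / ((n - 1).factorial : ℝ) *
        expSumDensity a.ofLp Finset.univ 0) := by
  obtain ⟨p, hp⟩ := hpos
  obtain ⟨m, hm⟩ := hneg
  have hn : 0 < n := by
    rcases Nat.eq_zero_or_pos n with rfl | h
    · rw [show p = m from Subsingleton.elim (α := Fin 1) p m] at hp; exact absurd hp hm.not_gt
    · exact h
  have ha0 : a ≠ 0 := by rintro rfl; simp at ha
  set e : EuclideanSpace ℝ (Fin (n + 1)) := WithLp.toLp 2 fun _ => (1 : ℝ) with he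
  set W : Submodule ℝ (EuclideanSpace ℝ (Fin (n + 1))) := (Submodule.span ℝ {a})ᗮ with hW
  have hrank : Module.finrank ℝ W = n :=
    haveI : Fact (Module.finrank ℝ (EuclideanSpace ℝ (Fin (n + 1))) = n + 1) :=
      ⟨finrank_euclideanSpace_fin⟩
    Submodule.finrank_orthogonal_span_singleton ha0
  have hmemW : ∀ x, x ∈ W ↔ inner ℝ a x = 0 := fun x =>
    Submodule.mem_orthogonal_singleton_iff_inner_right
  have hes : inner ℝ a e = ∑ j, a j := by rw [real_inner_comm]; exact inner_toLp_one a
  have hqW : e - (∑ j, a j) • a ∈ W := by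
    rw [hmemW, inner_sub_right, inner_smul_right, real_inner_self_eq_norm_sq, ha, hes]
    simp
  -- The orthogonal projection of `e` to `a^⊥`; it represents the functional `∑ x j` there.
  set q : W := ⟨e - (∑ j, a j) • a, hqW⟩ with hq_def
  have hqin : ∀ x : W, inner ℝ q x = ∑ j, (x : EuclideanSpace ℝ (Fin (n + 1))) j := fun x => by
    rw [Submodule.coe_inner, hq_def, inner_sub_left, inner_smul_left, (hmemW _).1 x.2, mul_zero,
      sub_zero, he, inner_toLp_one]
  have hq0 : q ≠ 0 := by
    intro h
    have h1 : e - (∑ j, a j) • a = 0 := congrArg Subtype.val h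
    -- If `q = 0`, then `e` is a multiple of `a`, so all `a j` have the same sign, contrary to `hp`
    -- and `hm`.
    have h2 : ∀ j, (∑ j, a j) * a j = 1 := fun j => by
      have := congrArg (fun z : EuclideanSpace ℝ (Fin (n + 1)) => z j) h1
      simp only [he, PiLp.sub_apply, PiLp.smul_apply, PiLp.zero_apply, smul_eq_mul] at this
      linarith
    have hs : 0 < ∑ j, a j := pos_of_mul_pos_left (by rw [h2 p]; exact one_pos) hp.le
    linarith [h2 m, mul_neg_of_pos_of_neg hs hm]
  have hqn : ‖q‖ = √((n : ℝ) + 1 - (∑ j, a j) ^ 2) := by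
    rw [eq_comm, Real.sqrt_eq_iff_eq_sq ?_ (norm_nonneg _)]
    all_goals
      have h : ‖q‖ ^ 2 = (n : ℝ) + 1 - (∑ j, a j) ^ 2 := by
        rw [← real_inner_self_eq_norm_sq, hqin]
        simp [hq_def, he, Finset.sum_sub_distrib, ← Finset.mul_sum, sq]
    · exact h.symm
    · rw [← h]; positivity
  set C : Set W := {x | ∀ j, 0 ≤ (x : EuclideanSpace ℝ (Fin (n + 1))) j} with hC
  have hCm : MeasurableSet C := by
    rw [hC, Set.ofPred_forall]
    exact MeasurableSet.iInter fun j => measurableSet_le measurable_const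
      (by fun_prop : Continuous fun x : W => (x : EuclideanSpace ℝ (Fin (n + 1))) j).measurable
  have hcone := euclideanHausdorffMeasure_cone_inter_le hCm
    (fun r hr y hy j => mul_nonneg hr.le (hy j)) hq0
    (fun y hy => by rw [hqin]; exact Finset.sum_nonneg fun j _ => hy j)
  rw [hrank] at hcone
  have hbase : μHE[n - 1] (C ∩ {y | inner ℝ q y = 1}) =
      μHE[n - 1] (hyperplane a 0 ∩ regularSimplex n) := by
    rw [← isometry_subtype_coe.euclideanHausdorffMeasure_image]
    congr 1
    ext x
    simp only [Set.mem_image, Subtype.exists, Set.mem_inter_iff, Set.mem_ofPred_eq, hqin, hC,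
      hyperplane, regularSimplex, ← hmemW]
    constructor
    · rintro ⟨y, hy, ⟨h1, h2⟩, rfl⟩; exact ⟨hy, h2, h1⟩
    · rintro ⟨h1, h2, h3⟩; exact ⟨x, h1, ⟨h3, h2⟩, rfl⟩
  set L := graphMap p fun k => -a (p.succAbove k) / a p with hL
  have hLc : Continuous L := L.continuous_of_finiteDimensional
  set D : Set (EuclideanSpace ℝ (Fin n)) := {y | ∀ j, 0 ≤ L y j} with hD
  have hDm : MeasurableSet D := by
    rw [hD, Set.ofPred_forall]
    exact MeasurableSet.iInter fun j => measurableSet_le measurable_const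
      (by fun_prop : Continuous fun y => L y j).measurable
  set l : EuclideanSpace ℝ (Fin n) →L[ℝ] ℝ := innerSL ℝ e ∘L L.toContinuousLinearMap with hl
  have hl_apply : ∀ y, l y = ∑ j, L y j := fun y => by simp [hl, he, inner_toLp_one]
  have himage : Subtype.val '' (C ∩ {y | inner ℝ q y ≤ 1}) = L '' (D ∩ {y | l y ≤ 1}) := by
    ext x
    simp only [Set.mem_image, Subtype.exists, Set.mem_inter_iff, Set.mem_ofPred_eq, hqin, hC, hD,
      hl_apply]
    constructor
    · rintro ⟨y, hy, h, rfl⟩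
      have h1 := (mem_range_graphMap_iff p _ y).1
        ((inner_eq_zero_iff_mem_graph hp y).1 ((hmemW y).1 hy))
      rw [← hL] at h1
      exact ⟨_, by rwa [h1], h1⟩
    · rintro ⟨y, h, rfl⟩
      refine ⟨L y, ?_, h, rfl⟩
      rw [hmemW, inner_eq_zero_iff_mem_graph hp]
      simp [hL]
  have hvol := L.euclideanHausdorffMeasure_image_eq_normDet_mul_volume (D ∩ {y | l y ≤ 1})
  rw [finrank_euclideanSpace_fin, ← himage,
    isometry_subtype_coe.euclideanHausdorffMeasure_image, hcone, hbase, hL,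
    normDet_graphMap_neg_div ha hp] at hvol
  have hexp := lintegral_exp_neg_cone volume hDm
    (fun r hr y hy j => by rw [map_smul]; exact mul_nonneg hr.le (hy j)) l
    (fun y hy => by rw [hl_apply]; exact Finset.sum_nonneg fun j _ => hy j)
  obtain ⟨hint, hF⟩ := lintegral_exp_neg_sum_graphMap hp hdistinct
  simp_rw [hl_apply] at hexp hvol
  rw [hint, finrank_euclideanSpace_fin] at hexp
  set F := expSumDensity a.ofLp Finset.univ 0
  set M := μHE[n - 1] (hyperplane a 0 ∩ regularSimplex n)
  set v := volume (D ∩ {y | ∑ j, L y j ≤ 1})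
  have hqpos : 0 < ‖q‖ := norm_pos_iff.2 hq0
  have hfac : (n.factorial : ℝ) = n * (n - 1).factorial := by
    exact_mod_cast (Nat.mul_factorial_pred hn.ne').symm
  have hnR : (0 : ℝ) < n := by exact_mod_cast hn
  have hfpos : (0 : ℝ) < (n - 1).factorial := by exact_mod_cast Nat.factorial_pos _
  rw [← hqn]
  -- The Jacobian `(a p)⁻¹` of the graph map cancels the factor `a p` of the exponential integral.
  -- Working in `ENNReal` yields finiteness of `M` along with its value.
  calc M = ENNReal.ofReal (‖q‖ * n) * (ENNReal.ofReal (‖q‖⁻¹ / n) * M) := by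
        rw [← mul_assoc, ← ENNReal.ofReal_mul (by positivity),
          show ‖q‖ * n * (‖q‖⁻¹ / n) = 1 by field_simp, ENNReal.ofReal_one, one_mul]
    _ = ENNReal.ofReal (‖q‖ * n * (a p)⁻¹ / n.factorial) * ((n.factorial : ENNReal) * v) := by
        rw [hvol, ← ENNReal.ofReal_natCast, ← mul_assoc, ← mul_assoc,
          ← ENNReal.ofReal_mul (by positivity), ← ENNReal.ofReal_mul (by positivity)]
        congr 2
        field_simp
    _ = ENNReal.ofReal (‖q‖ / (n - 1).factorial * F) := by
        rw [← hexp, ← ENNReal.ofReal_mul (by positivity), hfac]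
        congr 1
        field_simp

/-- Volume is Mathlib's Euclidean Hausdorff measure `μHE[n - 1]`, which on every affine subspace
of dimension `n - 1` is the induced Lebesgue measure. The sign hypotheses force `1 ≤ n`. -/
theorem mainTheorem2 (n : ℕ) (a : EuclideanSpace ℝ (Fin (n + 1))) (ha : ‖a‖ = 1)
    (hdistinct : ∀ i j, 0 < a i → 0 < a j → i ≠ j → a i ≠ a j)
    (hpos : ∃ j, 0 < a j) (hneg : ∃ j, a j < 0) :
    μHE[n - 1] (hyperplane a 0 ∩ regularSimplex n) ≠ ⊤ ∧
    (μHE[n - 1] (hyperplane a 0 ∩ regularSimplex n)).toReal =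
      √((n : ℝ) + 1 - (∑ j, a j) ^ 2) / ((n - 1).factorial : ℝ) *
        ∑ j ∈ Finset.univ.filter (fun j => 0 < a j),
          1 / a j * ∏ k ∈ Finset.univ.erase j, a j / (a j - a k) := by
  have hF : expSumDensity a.ofLp Finset.univ 0 = ∑ j ∈ Finset.univ.filter (fun j => 0 < a j),
      1 / a j * ∏ k ∈ Finset.univ.erase j, a j / (a j - a k) := by
    simp [expSumDensity]
  have h0 : 0 ≤ expSumDensity a.ofLp Finset.univ 0 :=
    (lintegral_exp_neg_sum_graphMap hpos.choose_spec hdistinct).2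
  rw [euclideanHausdorffMeasure_hyperplane_inter_regularSimplex ha hdistinct hpos hneg]
  exact ⟨ENNReal.ofReal_ne_top, by rw [ENNReal.toReal_ofReal (by positivity), hF]⟩
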